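/- **Setting.** Let $\Pi$ be a finite ground HEX-program, i.e. a finite set of rules $a_1\vee\dots\vee a_k\leftarrow b_1,\dots,b_m,\mathrm{not}\,b_{m+1},\dots,\mathrm{not}\,b_n$ ($k\ge 0$) whose $a_i$ are ordinary ground atoms and whose $b_i$ are ordinary ground atoms or ground external atoms $\&g[\vec p](\vec c)$; the truth value of $\&g[\vec p](\vec c)$ under an assignment $\mathbf A$ is $f_{\&g}(\mathbf A,\vec p,\vec c)\in\{0,1\}$ for an arbitrary oracle function $f_{\&g}$. The guessing program $\hat\Pi$ results from $\Pi$ by replacing each external atom $\&g[\vec p](\vec c)$ by a fresh atom $e_{\&g[\vec p]}(\vec c)$ and adding the rules $e_{\&g[\vec p]}(\vec c)\vee ne_{\&g[\vec p]}(\vec c)\leftarrow$. A compatible set of $\Pi$ is an answer set (minimal model of its Gelfond–Lifschitz reduct) $\mathbf A$ of $\hat\Pi$ such that, for all external atoms of $\Pi$, $f_{\&g}(\mathbf A,\vec p,\vec c)=1$ iff $e_{\&g[\vec p]}(\vec c)$ is true in $\mathbf A$. For a program $P$, let $A(P)$ be its atoms, $BA(P)$ its rule bodies viewed as fresh atoms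 (representing the conjunction of their default literals), and $sh(P)=\{a\leftarrow B(r),\mathrm{not}\,a'\ (a'\in H(r)\setminus\{a\})\mid r\in P,\ a\in H(r)\}$ the shifted program. Nogoods are sets of signed literals $\mathbf Tv,\mathbf Fv$ over $V=A(\hat\Pi)\cup BA(\hat\Pi)\cup BA(sh(\hat\Pi))$; an assignment is a solution to a nogood $\delta$ if it does not contain $\delta$, and to a set of nogoods if it is a solution to each of them; here an interpretation of $A(\hat\Pi)$ is identified with its extension to $V$ that gives each body the truth value of its conjunction. A nogood is correct for $\Pi$ if all compatible sets of $\Pi$ are solutions to it. A learning function $\Lambda$ maps each external predicate with input list $\&g[\vec p]$ of $\Pi$ and each set $\mathbf A$ of signed literals over $V$ to a set $\Lambda(\&g[\vec p],\mathbf A)$ of nogoods; it is correct for $\Pi$ if all these nogoods are correct for $\Pi$. **Algorithm HEX-CDNL**, on input $\Pi$, $\hat\Pi$ and a set $\nabla$ of nogoods. Let $\overline\sigma$ be the complement of the signed literal $\sigma$, let $B^+(r)$ be the positive body of $r$, let $sup_P(U)=\{r\in P\mid H(r)\cap U\ne\emptyset,\ B^+(r)\cap U=\emptyset\}$ and $sat_r(U)=\{\mathbf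 FB(r)\}\cup\{\mathbf Ta\mid a\in H(r)\setminus U\}$. The static nogoods are Clark's completion $\Delta_{\hat\Pi}$, i.e. for each $r\in\hat\Pi$ the nogoods $\gamma(B(r))$ stating that $B(r)$ is equivalent to the conjunction of its default literals, and $\{\mathbf TB(r)\}\cup\{\mathbf Fa\mid a\in H(r)\}$; and $\Theta_{sh(\hat\Pi)}$, i.e. $\gamma(B(r))$ for each $r\in sh(\hat\Pi)$, and $\{\mathbf Ta\}\cup\{\mathbf FB(r)\mid r\in sup_{sh(\hat\Pi)}(\{a\})\}$ for each $a\in A(sh(\hat\Pi))$. A set $U\subseteq A(\hat\Pi)$ is unfounded wrt. $\mathbf A$ if $sat_r(U)\cap\mathbf A\ne\emptyset$ for all $r\in sup_{\hat\Pi}(U)$; its loop nogoods $\lambda_{\hat\Pi}(U)$ consist of $\mathbf Ta$ for some $a\in U$ and one element of $sat_r(U)$ for each $r\in sup_{\hat\Pi}(U)$. The algorithm starts with the empty assignment $\mathbf A$ (an ordered sequence of signed literals with decision levels) and $dl=0$, and repeats the following, where "current nogoods" means $\Delta_{\hat\Pi}\cup\Theta_{sh(\hat\Pi)}\cup\nabla$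 for the present $\nabla$, and where all choices are arbitrary. * Propagation: repeatedly either pick a current nogood $\delta$ all of whose literals but one, $d$, are in $\mathbf A$, with $d,\overline d\notin\mathbf A$, and append $\overline d$ to $\mathbf A$ with the highest level of the literals in $\delta\setminus\{d\}$ ($0$ if there are none), or, for an unfounded set $U$ and $a\in U$ with $\mathbf Fa\notin\mathbf A$, add to $\nabla$ a loop nogood $\delta\in\lambda_{\hat\Pi}(U)$ that contains $\mathbf Ta$ for this $a$ and satisfies $\delta\setminus\{\mathbf Ta\}\subseteq\mathbf A$; stop at a state in which some current nogood is contained in $\mathbf A$ or no current nogood is unit. * (a) If some current nogood $\delta\subseteq\mathbf A$: return $\bot$ if $dl=0$; otherwise compute $(\epsilon,k)$ by conflict analysis of such a $\delta$, add $\epsilon$ to $\nabla$, set $dl=k$ and remove from $\mathbf A$ all literals of level $>k$. Conflict analysis: while the nogood has several literals of its highest decision level, resolve it with the reason of one of these (a reason of $\sigma\in\mathbf A$ is a current nogood $\rho\ni\overline\sigma$ with all literals of $\rho\setminus\{\overline\sigma\}$ assigned before $\sigma$); the result is $\epsilon$, and $k$ is its second-highest level ($0$ if there is none). * (b) Otherwise,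 if all of $V$ is assigned: if there is no nonempty unfounded set of true atoms, return the interpretation whose true atoms are the $a\in A(\hat\Pi)$ with $\mathbf Ta\in\mathbf A$; else choose such a set $U$ and $\delta\in\lambda_{\hat\Pi}(U)$ with $\delta\subseteq\mathbf A$, return $\bot$ if all literals of $\delta$ have level $0$, and otherwise analyze $\delta$ and backjump as in (a). * (c) Otherwise, possibly (decided by a heuristic) choose some $\&g[\vec p]$ of $\Pi$ and add $\Lambda(\&g[\vec p],\mathbf A)$ to $\nabla$. * (d) Otherwise, increment $dl$ and append to $\mathbf A$ a signed literal over an unassigned element of $V$, with level $dl$. **Proposition.** Let $\Lambda$ be a learning function that is correct for $\Pi$, and let $\nabla$ be any set of nogoods over $V$. (i) If HEX-CDNL on input $\Pi,\hat\Pi,\nabla$ returns an interpretation $\mathbf A$, then $\mathbf A$ is an answer set of $\hat\Pi$ and a solution to $\nabla$. (ii) If HEX-CDNL on input $\Pi,\hat\Pi,\nabla$ returns $\bot$, then $\Pi$ has no compatible set that is a solution to $\nabla$. -/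

import Mathlib

namespace HexCDNL

/-! ### Signed literals, nogoods -/

/-- Signed literals `T v`, `F v` over a set `V` of (propositional) atoms. -/
inductive SLit (V : Type*) where
  | T (v : V)
  | F (v : V)

namespace SLit

variable {V : Type*}

/-- The atom of a signed literal. -/
def var : SLit V → V
  | T v => v
  | F v => v

/-- The complementary signed literal. -/
def compl : SLit V → SLit V
  | T v => F v
  | F v => T v

/-- Truth of a signed literal under a valuation of the atoms. -/
def Holds (val : V → Prop) : SLit V → Prop
  | T v => val v
  | F v => ¬ val v

end SLit

/-- A nogood is a set of signed literals. -/
abbrev Nogood (V : Type*) := Set (SLit V)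

/-- `A` is a solution to the nogood `δ`. -/
def SolvesNogood {V : Type*} (A : Set (SLit V)) (δ : Nogood V) : Prop := ¬ δ ⊆ A

/-- `A` is a solution to the set `N` of nogoods. -/
def Solves {V : Type*} (A : Set (SLit V)) (N : Set (Nogood V)) : Prop :=
  ∀ δ ∈ N, SolvesNogood A δ

/-! ### Ground disjunctive rules and programs -/

/-- A rule body `b₁, …, bₘ, not bₘ₊₁, …, not bₙ`, as its positive and its negative part. -/
structure Body (β : Type*) where
  pos : Finset β
  neg : Finset β

/-- A rule with a disjunctive (possibly empty) head of elements of `α` and body over `β`. -/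
structure Rule (α β : Type*) where
  head : Finset α
  body : Body β

/-- Ordinary ground disjunctive logic programs over a set `α` of atoms. -/
abbrev Program (α : Type*) := Set (Rule α α)

section Ordinary

variable {α : Type*}

/-- The body `b` is true under the interpretation `I` (the set of true atoms). -/
def Body.Sat (I : Set α) (b : Body α) : Prop :=
  (∀ a ∈ b.pos, a ∈ I) ∧ ∀ a ∈ b.neg, a ∉ I

/-- `J` is a model of the Gelfond-Lifschitz reduct of `P` with respect to `I`. -/
def IsModelOfReduct (P : Program α) (I J : Set α) : Prop :=
  ∀ r ∈ P, (∀ a ∈ r.body.neg, a ∉ I) → (∀ a ∈ r.body.pos, a ∈ J) → ∃ a ∈ r.head, a ∈ J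

/-- `I` is an answer set of `P`: a minimal model of the reduct of `P` with respect to `I`. -/
def IsAnswerSet (P : Program α) (I : Set α) : Prop :=
  IsModelOfReduct P I I ∧ ∀ J, J ⊆ I → IsModelOfReduct P I J → J = I

/-- `A(P)`: the atoms occurring in `P`. -/
def atoms (P : Program α) : Set α :=
  {a | ∃ r ∈ P, a ∈ r.head ∨ a ∈ r.body.pos ∨ a ∈ r.body.neg}

/-- `BA(P)`: the bodies of the rules of `P`. -/
def bodies (P : Program α) : Set (Body α) := {b | ∃ r ∈ P, r.body = b}

open scoped Classical in
/-- The shifted rule `a ← B(r), not a₁, …, not aₗ`, where `a₁, …, aₗ` are the other elements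
of the head of `r`. -/
noncomputable def shiftRule (r : Rule α α) (a : α) : Rule α α :=
  ⟨{a}, ⟨r.body.pos, r.body.neg ∪ r.head.erase a⟩⟩

/-- The shifted program `sh(P)`. -/
def shift (P : Program α) : Program α := {s | ∃ r ∈ P, ∃ a ∈ r.head, s = shiftRule r a}

/-- External support of `Y`: the rules with a head atom in `Y` whose positive body avoids `Y`. -/
def sup (P : Program α) (Y : Set α) : Set (Rule α α) :=
  {r ∈ P | (∃ a ∈ r.head, a ∈ Y) ∧ ∀ a ∈ r.body.pos, a ∉ Y}

/-- The propositional atoms of the solver: atoms of the program, and rule bodies viewed as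
fresh atoms. -/
inductive Var (α : Type*) where
  | atom (a : α)
  | body (b : Body α)

/-- `A(P) ∪ BA(P) ∪ BA(sh(P))`. -/
def solverVars (P : Program α) : Set (Var α) :=
  {v | (∃ a ∈ atoms P, v = .atom a) ∨ ∃ b ∈ bodies P ∪ bodies (shift P), v = .body b}

/-- The signed literals over `A(P) ∪ BA(P) ∪ BA(sh(P))`. -/
def solverLits (P : Program α) : Set (SLit (Var α)) := {σ | σ.var ∈ solverVars P}

/-- Truth value of a solver atom under an interpretation: a body atom stands for the conjunction
of the default literals in the body. -/
def Var.Val (I : Set α) : Var α → Prop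
  | .atom a => a ∈ I
  | .body b => b.Sat I

/-- The total assignment over `A(P)` given by the interpretation `I`. -/
def assignment (P : Program α) (I : Set α) : Set (SLit α) :=
  {σ | σ.var ∈ atoms P ∧ σ.Holds (· ∈ I)}

/-- The total assignment over `A(P) ∪ BA(P) ∪ BA(sh(P))` given by the interpretation `I`; it
extends `assignment P I` by the truth values of the rule bodies. -/
def fullAssignment (P : Program α) (I : Set α) : Set (SLit (Var α)) :=
  {σ | σ ∈ solverLits P ∧ σ.Holds (Var.Val I)}

/-! ### Static nogoods and loop nogoods -/

/-- The signed literals saying that the default literals of `b` are true (`t ℓ` for `ℓ ∈ b`). -/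
def Body.trueLits (b : Body α) : Set (SLit (Var α)) :=
  {σ | (∃ a ∈ b.pos, σ = .T (.atom a)) ∨ ∃ a ∈ b.neg, σ = .F (.atom a)}

/-- `γ(C)`: the nogoods saying that the body atom `C` is equivalent to the conjunction of its
default literals. -/
def gamma (C : Body α) : Set (Nogood (Var α)) :=
  {insert (.F (.body C)) C.trueLits} ∪ {δ | ∃ σ ∈ C.trueLits, δ = {.T (.body C), σ.compl}}

/-- Clark's completion `Δ_P`. -/
def completion (P : Program α) : Set (Nogood (Var α)) :=
  {δ | ∃ r ∈ P, δ ∈ gamma r.body ∨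
    δ = insert (.T (.body r.body)) {σ | ∃ a ∈ r.head, σ = .F (.atom a)}}

/-- `Θ_sh(P)`: the nogoods that define the bodies of the shifted program, and the loop nogoods
`{T a} ∪ {F B(r) | r ∈ sup_sh(P)({a})}` of its singleton loops. -/
def singletonLoops (P : Program α) : Set (Nogood (Var α)) :=
  {δ | (∃ r ∈ shift P, δ ∈ gamma r.body) ∨ ∃ a ∈ atoms (shift P),
    δ = insert (.T (.atom a)) {σ | ∃ r ∈ sup (shift P) {a}, σ = .F (.body r.body)}}

/-- The static nogoods `Δ_P ∪ Θ_sh(P)`. -/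
def staticNogoods (P : Program α) : Set (Nogood (Var α)) := completion P ∪ singletonLoops P

/-- `sat_r(Y)`: the signed literals that satisfy the rule `r` independently of `Y`. -/
def indepSat (r : Rule α α) (Y : Set α) : Set (SLit (Var α)) :=
  {σ | σ = .F (.body r.body) ∨ ∃ a ∈ r.head, a ∉ Y ∧ σ = .T (.atom a)}

/-- The loop nogoods in `λ_P(U)` for the atom `a ∈ U`: one literal of `sat_r(U)` for each rule `r`
in the external support of `U`, together with `T a`. -/
def loopNogoodsFor (P : Program α) (U : Set α) (a : α) : Set (Nogood (Var α)) :=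
  {δ | ∃ s : Rule α α → SLit (Var α), (∀ r ∈ sup P U, s r ∈ indepSat r U) ∧
    δ = insert (.T (.atom a)) (s '' sup P U)}

/-- `λ_P(U)`: all loop nogoods for the set `U`. -/
def loopNogoods (P : Program α) (U : Set α) : Set (Nogood (Var α)) :=
  {δ | ∃ a ∈ U, δ ∈ loopNogoodsFor P U a}

/-- `U` is unfounded for `P` with respect to the (partial) assignment `A`: every rule in the
external support of `U` has a false body or a true head atom outside `U`. -/
def IsUnfounded (P : Program α) (A : Set (SLit (Var α))) (U : Set α) : Prop :=
  U ⊆ atoms P ∧ ∀ r ∈ sup P U, (indepSat r U ∩ A).Nonempty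

end Ordinary

/-! ### HEX-programs -/

section Hex

/-- Ordinary ground atoms `p(c₁, …, cₗ)`. -/
structure OrdAtom (Pred Const : Type*) where
  pred : Pred
  args : List Const

/-- An external predicate with input list `&g[p₁, …, pₖ]`; each `pᵢ` is a predicate name or an
object constant. -/
structure ExtPred (Pred Const Ext : Type*) where
  name : Ext
  inputs : List (Pred ⊕ Const)

/-- Ground external atoms `&g[p₁, …, pₖ](c₁, …, cₗ)`. -/
structure ExtAtom (Pred Const Ext : Type*) where
  epred : ExtPred Pred Const Ext
  outputs : List Const

/-- Atoms of guessing programs: ordinary atoms, and the fresh replacement atoms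
`e_{&g[p]}(c)` and `ne_{&g[p]}(c)`. -/
inductive GAtom (Pred Const Ext : Type*) where
  | ord (a : OrdAtom Pred Const)
  | e (x : ExtAtom Pred Const Ext)
  | ne (x : ExtAtom Pred Const Ext)

variable {Pred Const Ext : Type*}

/-- Ground HEX-programs: rules with ordinary atoms in the head and ordinary or external atoms in
the body. -/
abbrev HexProgram (Pred Const Ext : Type*) :=
  Set (Rule (OrdAtom Pred Const) (OrdAtom Pred Const ⊕ ExtAtom Pred Const Ext))

/-- The external atoms occurring in a HEX-program. -/
def extAtoms (Q : HexProgram Pred Const Ext) : Set (ExtAtom Pred Const Ext) :=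
  {x | ∃ r ∈ Q, .inr x ∈ r.body.pos ∨ .inr x ∈ r.body.neg}

/-- The external predicates with input list occurring in a HEX-program. -/
def extPreds (Q : HexProgram Pred Const Ext) : Set (ExtPred Pred Const Ext) :=
  {g | ∃ x ∈ extAtoms Q, x.epred = g}

/-- Replacement of external atoms by their replacement atoms. -/
def replaceAtom : OrdAtom Pred Const ⊕ ExtAtom Pred Const Ext → GAtom Pred Const Ext
  | .inl a => .ord a
  | .inr x => .e x

open scoped Classical in
/-- Replacement of the external atoms in a rule. -/
noncomputable def replaceRule
    (r : Rule (OrdAtom Pred Const) (OrdAtom Pred Const ⊕ ExtAtom Pred Const Ext)) :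
    Rule (GAtom Pred Const Ext) (GAtom Pred Const Ext) :=
  ⟨r.head.image GAtom.ord, ⟨r.body.pos.image replaceAtom, r.body.neg.image replaceAtom⟩⟩

open scoped Classical in
/-- The guessing rule `e_{&g[p]}(c) ∨ ne_{&g[p]}(c) ←`. -/
noncomputable def guessRule (x : ExtAtom Pred Const Ext) :
    Rule (GAtom Pred Const Ext) (GAtom Pred Const Ext) :=
  ⟨{.e x, .ne x}, ⟨∅, ∅⟩⟩

/-- The guessing program of a HEX-program. -/
def guessing (Q : HexProgram Pred Const Ext) : Program (GAtom Pred Const Ext) :=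
  {s | (∃ r ∈ Q, s = replaceRule r) ∨ ∃ x ∈ extAtoms Q, s = guessRule x}

/-- Oracle functions: a Boolean value for each external predicate name, assignment, input list
and output list. -/
abbrev Oracle (Pred Const Ext : Type*) :=
  Ext → Set (SLit (GAtom Pred Const Ext)) → List (Pred ⊕ Const) → List Const → Bool

/-- Compatible sets of a HEX-program, given as the set of true atoms: the answer sets of the
guessing program whose guessed values coincide with the values of the external atoms. -/
def IsCompatibleSet (f : Oracle Pred Const Ext) (Q : HexProgram Pred Const Ext)
    (I : Set (GAtom Pred Const Ext)) : Prop :=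
  IsAnswerSet (guessing Q) I ∧
    ∀ x ∈ extAtoms Q,
      f x.epred.name (assignment (guessing Q) I) x.epred.inputs x.outputs = true ↔ .e x ∈ I

/-- A nogood is correct for a program if all compatible sets are solutions to it. -/
def IsCorrectNogood (f : Oracle Pred Const Ext) (Q : HexProgram Pred Const Ext)
    (δ : Nogood (Var (GAtom Pred Const Ext))) : Prop :=
  ∀ I, IsCompatibleSet f Q I → SolvesNogood (fullAssignment (guessing Q) I) δ

/-- Maps from external predicates with input list and sets of signed literals to sets of nogoods. -/
abbrev Learning (Pred Const Ext : Type*) :=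
  ExtPred Pred Const Ext → Set (SLit (Var (GAtom Pred Const Ext))) →
    Set (Nogood (Var (GAtom Pred Const Ext)))

/-- `Λ` is a learning function for the program: the learned nogoods consist of signed literals
of the solver. -/
def IsLearningFunction (Q : HexProgram Pred Const Ext) (Λ : Learning Pred Const Ext) : Prop :=
  ∀ g ∈ extPreds Q, ∀ A ⊆ solverLits (guessing Q), ∀ δ ∈ Λ g A, δ ⊆ solverLits (guessing Q)

/-- The learning function `Λ` is correct for the program. -/
def IsCorrectLearning (f : Oracle Pred Const Ext) (Q : HexProgram Pred Const Ext)
    (Λ : Learning Pred Const Ext) : Prop :=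
  ∀ g ∈ extPreds Q, ∀ A ⊆ solverLits (guessing Q), ∀ δ ∈ Λ g A, IsCorrectNogood f Q δ

end Hex

/-! ### The algorithm

The subroutines, heuristics and all choices are modelled by relations: a run may take any of the
permitted choices. -/

section Algorithm

variable {α : Type*}

/-- The assignment under construction: signed literals with decision levels, in the order in which
they were assigned. -/
abbrev Trail (α : Type*) := List (SLit (Var α) × ℕ)

/-- The signed literals in a trail. -/
def Trail.lits (A : Trail α) : Set (SLit (Var α)) := {σ | ∃ l, (σ, l) ∈ A}

/-- The decision levels of the literals of `δ`. -/
def Trail.levels (A : Trail α) (δ : Nogood (Var α)) : Set ℕ := {l | ∃ σ ∈ δ, (σ, l) ∈ A}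

/-- State of the solver: assignment, dynamic nogoods, current decision level. -/
structure State (α : Type*) where
  trail : Trail α
  nabla : Set (Nogood (Var α))
  dl : ℕ

/-- All current nogoods `Δ_P ∪ Θ_sh(P) ∪ ∇`. -/
def State.nogoods (P : Program α) (S : State α) : Set (Nogood (Var α)) :=
  staticNogoods P ∪ S.nabla

/-- Some current nogood is violated. -/
def State.Conflict (P : Program α) (S : State α) : Prop :=
  ∃ δ ∈ S.nogoods P, δ ⊆ S.trail.lits

/-- The nogood `δ` is unit under `A`: all its literals but the unassigned literal `d` are in `A`. -/
def IsUnit (A : Trail α) (δ : Nogood (Var α)) (d : SLit (Var α)) : Prop :=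
  d ∈ δ ∧ δ \ {d} ⊆ A.lits ∧ d ∉ A.lits ∧ d.compl ∉ A.lits

/-- One propagation step. -/
inductive PropStep (P : Program α) : State α → State α → Prop
  /-- Unit propagation; the derived literal gets the highest level of the literals implying it. -/
  | unit (S : State α) (δ : Nogood (Var α)) (d : SLit (Var α)) (l : ℕ)
      (hδ : δ ∈ S.nogoods P) (hd : IsUnit S.trail δ d)
      (hl : IsGreatest (insert 0 (S.trail.levels (δ \ {d}))) l) :
      PropStep P S ⟨S.trail ++ [(d.compl, l)], S.nabla, S.dl⟩
  /-- Unfounded set propagation: for an atom `a` of an unfounded set that is not yet false, a loop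
  nogood whose other literals are satisfied is added; by it, `a` is falsified or a conflict
  arises. -/
  | unfounded (S : State α) (U : Set α) (a : α) (δ : Nogood (Var α))
      (hU : IsUnfounded P S.trail.lits U) (ha : a ∈ U) (haF : .F (.atom a) ∉ S.trail.lits)
      (hδ : δ ∈ loopNogoodsFor P U a) (hA : δ \ {.T (.atom a)} ⊆ S.trail.lits) :
      PropStep P S ⟨S.trail, insert δ S.nabla, S.dl⟩

/-- `Propagation`: propagation steps are performed until there is a conflict or no nogood is unit
(unfounded set propagation need not be exhaustive). -/
def Propagation (P : Program α) (S S' : State α) : Prop :=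
  Relation.ReflTransGen (PropStep P) S S' ∧
    (S'.Conflict P ∨ ∀ δ ∈ S'.nogoods P, ∀ d, ¬ IsUnit S'.trail δ d)

/-- The literals of `δ` with the highest decision level in `δ`. -/
def topLits (A : Trail α) (δ : Nogood (Var α)) : Set (SLit (Var α)) :=
  {σ ∈ δ | ∃ l, (σ, l) ∈ A ∧ ∀ m ∈ A.levels δ, m ≤ l}

/-- `ε` is a reason for `σ`: it was unit, and implied `σ`, under the literals preceding `σ`. -/
def IsReason (A : Trail α) (ε : Nogood (Var α)) (σ : SLit (Var α)) : Prop :=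
  ∃ (A₁ A₂ : Trail α) (l : ℕ), A = A₁ ++ (σ, l) :: A₂ ∧ σ.compl ∈ ε ∧ ε \ {σ.compl} ⊆ A₁.lits

/-- `Analysis`: `AnalysisRel N A δ ε k` says that conflict analysis of the violated nogood `δ`, with
reasons taken from `N`, may yield the learned nogood `ε` and the backtrack level `k`. -/
inductive AnalysisRel (N : Set (Nogood (Var α))) (A : Trail α) :
    Nogood (Var α) → Nogood (Var α) → ℕ → Prop
  /-- There are no multiple literals of the highest level: the nogood is learned; `k` is its
  second-highest level (`0` if there is none). -/
  | learned (δ : Nogood (Var α)) (k : ℕ) (h : (topLits A δ).Subsingleton)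
      (hk : IsGreatest (insert 0 {l ∈ A.levels δ | ∃ m ∈ A.levels δ, l < m}) k) :
      AnalysisRel N A δ δ k
  /-- There are multiple literals of the highest level: resolve with the reason of one of them. -/
  | resolve (δ : Nogood (Var α)) (σ : SLit (Var α)) (ρ ε : Nogood (Var α)) (k : ℕ)
      (h : ¬ (topLits A δ).Subsingleton) (hσ : σ ∈ topLits A δ)
      (hρ : ρ ∈ N) (hr : IsReason A ρ σ)
      (hrec : AnalysisRel N A ((δ \ {σ}) ∪ (ρ \ {σ.compl})) ε k) :
      AnalysisRel N A δ ε k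

/-- Learning the nogood `ε` and backjumping to level `k`. -/
def State.backjump (S : State α) (ε : Nogood (Var α)) (k : ℕ) : State α :=
  ⟨S.trail.filter (fun p => p.2 ≤ k), insert ε S.nabla, k⟩

/-- All solver atoms are assigned: `A^T ∪ A^F = A(P) ∪ BA(P) ∪ BA(sh(P))`. -/
def State.Complete (P : Program α) (S : State α) : Prop :=
  SLit.var '' S.trail.lits = solverVars P

/-- `UnfoundedSet`: the possible nonempty results are the nonempty unfounded sets of true atoms; the
result is empty if and only if there is none. -/
def UnfoundedSetRel (P : Program α) (A : Set (SLit (Var α))) (U : Set α) : Prop :=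
  (U.Nonempty ∧ IsUnfounded P A U ∧ ∀ a ∈ U, .T (.atom a) ∈ A) ∨
  (U = ∅ ∧ ¬ ∃ W : Set α, W.Nonempty ∧ IsUnfounded P A W ∧ ∀ a ∈ W, .T (.atom a) ∈ A)

variable {Pred Const Ext : Type*}

/-- Outcome of a loop iteration: continue in a new state, return an interpretation (given by its
set of true atoms), or return `⊥`. -/
inductive Outcome (α : Type*) where
  | next (S : State α)
  | interp (I : Set α)
  | bot

/-- The part of the loop body after propagation, for the program `Q`, its guessing program and the
learning function `Λ`. -/
inductive Branch (Q : HexProgram Pred Const Ext) (Λ : Learning Pred Const Ext) :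
    State (GAtom Pred Const Ext) → Outcome (GAtom Pred Const Ext) → Prop
  /-- Part (a): a conflict at decision level `0`. -/
  | conflictBot (S : State (GAtom Pred Const Ext)) (hc : S.Conflict (guessing Q)) (h0 : S.dl = 0) :
      Branch Q Λ S .bot
  /-- Part (a): a conflict that is analyzed. -/
  | conflict (S : State (GAtom Pred Const Ext)) (δ ε : Nogood (Var (GAtom Pred Const Ext))) (k : ℕ)
      (hδ : δ ∈ S.nogoods (guessing Q)) (hA : δ ⊆ S.trail.lits) (h0 : S.dl ≠ 0)
      (han : AnalysisRel (S.nogoods (guessing Q)) S.trail δ ε k) :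
      Branch Q Λ S (.next (S.backjump ε k))
  /-- Part (b): an unfounded set of a complete assignment, all at decision level `0`. -/
  | unfoundedBot (S : State (GAtom Pred Const Ext)) (U : Set (GAtom Pred Const Ext))
      (δ : Nogood (Var (GAtom Pred Const Ext)))
      (hc : ¬ S.Conflict (guessing Q)) (ht : S.Complete (guessing Q))
      (hU : UnfoundedSetRel (guessing Q) S.trail.lits U) (hne : U ≠ ∅)
      (hδ : δ ∈ loopNogoods (guessing Q) U) (hA : δ ⊆ S.trail.lits)
      (h0 : ∀ l ∈ S.trail.levels δ, l = 0) :
      Branch Q Λ S .bot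
  /-- Part (b): an unfounded set of a complete assignment; a violated loop nogood is analyzed. -/
  | unfounded (S : State (GAtom Pred Const Ext)) (U : Set (GAtom Pred Const Ext))
      (δ ε : Nogood (Var (GAtom Pred Const Ext))) (k : ℕ)
      (hc : ¬ S.Conflict (guessing Q)) (ht : S.Complete (guessing Q))
      (hU : UnfoundedSetRel (guessing Q) S.trail.lits U) (hne : U ≠ ∅)
      (hδ : δ ∈ loopNogoods (guessing Q) U) (hA : δ ⊆ S.trail.lits)
      (h0 : ¬ ∀ l ∈ S.trail.levels δ, l = 0)
      (han : AnalysisRel (S.nogoods (guessing Q)) S.trail δ ε k) :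
      Branch Q Λ S (.next (S.backjump ε k))
  /-- Part (b): a complete assignment without unfounded set: return `A^T ∩ A(P)`. -/
  | answer (S : State (GAtom Pred Const Ext))
      (hc : ¬ S.Conflict (guessing Q)) (ht : S.Complete (guessing Q))
      (hU : UnfoundedSetRel (guessing Q) S.trail.lits ∅) :
      Branch Q Λ S (.interp {a | .T (.atom a) ∈ S.trail.lits ∧ a ∈ atoms (guessing Q)})
  /-- Part (c): evaluation of an external predicate with input list. -/
  | learn (S : State (GAtom Pred Const Ext)) (g : ExtPred Pred Const Ext)
      (hc : ¬ S.Conflict (guessing Q)) (ht : ¬ S.Complete (guessing Q)) (hg : g ∈ extPreds Q) :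
      Branch Q Λ S (.next ⟨S.trail, S.nabla ∪ Λ g S.trail.lits, S.dl⟩)
  /-- Part (d): a guess for an unassigned solver atom (`Select`). -/
  | guess (S : State (GAtom Pred Const Ext)) (σ : SLit (Var (GAtom Pred Const Ext)))
      (hc : ¬ S.Conflict (guessing Q)) (ht : ¬ S.Complete (guessing Q))
      (hσ : σ ∈ solverLits (guessing Q)) (h1 : σ ∉ S.trail.lits) (h2 : σ.compl ∉ S.trail.lits) :
      Branch Q Λ S (.next ⟨S.trail ++ [(σ, S.dl + 1)], S.nabla, S.dl + 1⟩)

/-- `Run Q Λ S o`: the main loop, started in state `S`, may terminate and return `o`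
(`none` is `⊥`, `some I` is the interpretation `I`). -/
inductive Run (Q : HexProgram Pred Const Ext) (Λ : Learning Pred Const Ext) :
    State (GAtom Pred Const Ext) → Option (Set (GAtom Pred Const Ext)) → Prop
  | bot (S S' : State (GAtom Pred Const Ext)) (hp : Propagation (guessing Q) S S')
      (hb : Branch Q Λ S' .bot) : Run Q Λ S none
  | interp (S S' : State (GAtom Pred Const Ext)) (I : Set (GAtom Pred Const Ext))
      (hp : Propagation (guessing Q) S S') (hb : Branch Q Λ S' (.interp I)) : Run Q Λ S (some I)
  | next (S S' S'' : State (GAtom Pred Const Ext)) (o : Option (Set (GAtom Pred Const Ext)))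
      (hp : Propagation (guessing Q) S S') (hb : Branch Q Λ S' (.next S''))
      (hr : Run Q Λ S'' o) : Run Q Λ S o

/-- The algorithm, on input `Q`, its guessing program and `nabla`, may return `o`: a run from the
empty assignment at decision level `0`. -/
def Returns (Q : HexProgram Pred Const Ext) (Λ : Learning Pred Const Ext)
    (nabla : Set (Nogood (Var (GAtom Pred Const Ext))))
    (o : Option (Set (GAtom Pred Const Ext))) : Prop :=
  Run Q Λ ⟨[], nabla, 0⟩ o

end Algorithm

end HexCDNL

/-!
The proof follows a run with two kinds of invariants.

*Returned interpretations.* The trail never contains complementary literals, and the input nogoods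
are never removed. When the algorithm returns, the trail is total and violates no static nogood, so
the nogoods `γ(B)` force the literals of the bodies to agree with the atoms: the trail is the full
assignment of the returned interpretation `I` (`total_lits_eq_fullAssignment`). Hence `I` solves all
current nogoods, and the completion makes it a model of its reduct. If `J ⊆ I` is a model of the
reduct as well, then `I \ J` is an unfounded set of true atoms, so it is empty
(`IsModelOfReduct.isUnfounded_diff`).

*Returning `⊥`.* Fix a compatible set `I` that solves the input nogoods. Every nogood that the
algorithm ever uses is solved by `I`: the static nogoods and the loop nogoods because for an answer
set `I` and a set `U` meeting `I`, the set `I \ U` is not a model of the reduct, which yields a rule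
that supports `U` externally (`IsAnswerSet.exists_support`); the nogoods of `Λ` by correctness; and
the nogoods of conflict analysis because they arise by resolution, which is sound as `I` assigns
every solver variable (`AnalysisRel.solvedNogood`). Since literals of level `0` are obtained by unit
propagation from such nogoods only, they hold in `I`, so no nogood solved by `I` can be violated at
level `0` (`Sound.not_subset_of_levels_zero`).
-/

namespace HexCDNL

variable {α : Type*}

/-! ### Signed literals -/

@[simp] theorem SLit.compl_compl {V : Type*} (σ : SLit V) : σ.compl.compl = σ := by
  cases σ <;> rfl

@[simp] theorem SLit.var_compl {V : Type*} (σ : SLit V) : σ.compl.var = σ.var := by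
  cases σ <;> rfl

@[simp] theorem SLit.holds_compl {V : Type*} (val : V → Prop) (σ : SLit V) :
    σ.compl.Holds val ↔ ¬ σ.Holds val := by
  cases σ <;> simp [SLit.compl, SLit.Holds]

theorem SLit.compl_ne {V : Type*} (σ : SLit V) : σ.compl ≠ σ := by
  cases σ <;> simp [SLit.compl]

theorem SLit.eq_or_eq_compl {V : Type*} {σ τ : SLit V} (h : σ.var = τ.var) :
    σ = τ ∨ σ = τ.compl := by
  cases σ <;> cases τ <;> simp_all [SLit.var, SLit.compl]

theorem compl_mem_solverLits {P : Program α} {σ : SLit (Var α)} :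
    σ.compl ∈ solverLits P ↔ σ ∈ solverLits P := by
  simp [solverLits]

theorem compl_mem_fullAssignment {P : Program α} {I : Set α} {σ : SLit (Var α)}
    (hσ : σ ∈ solverLits P) : σ.compl ∈ fullAssignment P I ↔ σ ∉ fullAssignment P I := by
  simp [fullAssignment, compl_mem_solverLits, hσ]

/-! ### Solver variables of static nogoods and loop nogoods -/

theorem atom_mem_solverVars {P : Program α} {a : α} :
    Var.atom a ∈ solverVars P ↔ a ∈ atoms P := by
  simp [solverVars]

theorem body_mem_solverVars {P : Program α} {r : Rule α α} (hr : r ∈ P ∨ r ∈ shift P) :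
    Var.body r.body ∈ solverVars P :=
  Or.inr ⟨_, hr.imp (fun h => ⟨r, h, rfl⟩) (fun h => ⟨r, h, rfl⟩), rfl⟩

theorem atoms_shift_subset (P : Program α) : atoms (shift P) ⊆ atoms P := by
  classical
  rintro a ⟨_, ⟨r, hr, b, hb, rfl⟩, h⟩
  simp only [shiftRule, Finset.mem_singleton, Finset.mem_union, Finset.mem_erase] at h
  refine ⟨r, hr, ?_⟩
  rcases h with rfl | h | h | h
  exacts [.inl hb, .inr (.inl h), .inr (.inr h), .inl h.2]

theorem mem_atoms_of_mem_body {P : Program α} {r : Rule α α} (hr : r ∈ P ∨ r ∈ shift P) {a : α}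
    (ha : a ∈ r.body.pos ∨ a ∈ r.body.neg) : a ∈ atoms P :=
  hr.elim (fun h => ⟨r, h, .inr ha⟩) (fun h => atoms_shift_subset P ⟨r, h, .inr ha⟩)

theorem trueLits_subset_solverLits {P : Program α} {r : Rule α α} (hr : r ∈ P ∨ r ∈ shift P) :
    r.body.trueLits ⊆ solverLits P := by
  rintro _ (⟨a, ha, rfl⟩ | ⟨a, ha, rfl⟩)
  · exact atom_mem_solverVars.2 (mem_atoms_of_mem_body hr (.inl ha))
  · exact atom_mem_solverVars.2 (mem_atoms_of_mem_body hr (.inr ha))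

theorem subset_solverLits_of_mem_gamma {P : Program α} {r : Rule α α} (hr : r ∈ P ∨ r ∈ shift P)
    {δ : Nogood (Var α)} (hδ : δ ∈ gamma r.body) : δ ⊆ solverLits P := by
  rcases hδ with rfl | ⟨σ, hσ, rfl⟩
  · exact Set.insert_subset (body_mem_solverVars hr) (trueLits_subset_solverLits hr)
  · exact Set.insert_subset (body_mem_solverVars hr) (Set.singleton_subset_iff.2
      (compl_mem_solverLits.2 (trueLits_subset_solverLits hr hσ)))

theorem gamma_subset_staticNogoods {P : Program α} {r : Rule α α} (hr : r ∈ P ∨ r ∈ shift P) :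
    gamma r.body ⊆ staticNogoods P :=
  fun _ hδ => hr.elim (fun h => .inl ⟨r, h, .inl hδ⟩) (fun h => .inr (.inl ⟨r, h, hδ⟩))

theorem subset_solverLits_of_mem_staticNogoods {P : Program α} {δ : Nogood (Var α)}
    (hδ : δ ∈ staticNogoods P) : δ ⊆ solverLits P := by
  rcases hδ with ⟨r, hr, hδ | rfl⟩ | ⟨r, hr, hδ⟩ | ⟨a, ha, rfl⟩
  · exact subset_solverLits_of_mem_gamma (.inl hr) hδ
  · refine Set.insert_subset (body_mem_solverVars (.inl hr)) ?_
    rintro _ ⟨a, ha, rfl⟩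
    exact atom_mem_solverVars.2 ⟨r, hr, .inl ha⟩
  · exact subset_solverLits_of_mem_gamma (.inr hr) hδ
  · refine Set.insert_subset (atom_mem_solverVars.2 (atoms_shift_subset P ha)) ?_
    rintro _ ⟨r, hr, rfl⟩
    exact body_mem_solverVars (.inr hr.1)

theorem subset_solverLits_of_mem_loopNogoods {P : Program α} {U : Set α} (hU : U ⊆ atoms P)
    {δ : Nogood (Var α)} (hδ : δ ∈ loopNogoods P U) : δ ⊆ solverLits P := by
  obtain ⟨a, ha, s, hs, rfl⟩ := hδ
  refine Set.insert_subset (atom_mem_solverVars.2 (hU ha)) ?_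
  rintro _ ⟨r, hr, rfl⟩
  rcases hs r hr with h | ⟨b, hb, -, h⟩ <;> rw [h]
  · exact body_mem_solverVars (.inl hr.1)
  · exact atom_mem_solverVars.2 ⟨r, hr.1, .inl hb⟩

/-! ### Answer sets solve the static nogoods and the loop nogoods -/

/-- External support: by minimality, removing from an answer set a set that meets it does not leave
a model of the reduct, so some rule is violated, and this rule supports the removed set. -/
theorem IsAnswerSet.exists_support {P : Program α} {I : Set α} (hI : IsAnswerSet P I) {U : Set α}
    {a : α} (haU : a ∈ U) (haI : a ∈ I) :
    ∃ r ∈ sup P U, r.body.Sat I ∧ ∀ b ∈ r.head, b ∈ I → b ∈ U := by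
  by_contra! hno
  have hmodel : IsModelOfReduct P I (I \ U) := by
    intro r hr hneg hpos
    by_contra! hhead
    obtain ⟨b, hb, hbI⟩ := hI.1 r hr hneg fun c hc => (hpos c hc).1
    have hsub : ∀ c ∈ r.head, c ∈ I → c ∈ U := fun c hc hcI => by
      by_contra hcU
      exact hhead c hc ⟨hcI, hcU⟩
    obtain ⟨c, hc, hcI, hcU⟩ := hno r ⟨hr, ⟨b, hb, hsub b hb hbI⟩, fun c hc => (hpos c hc).2⟩
      ⟨fun c hc => (hpos c hc).1, hneg⟩
    exact hcU (hsub c hc hcI)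
  have heq := hI.2 _ Set.sdiff_subset hmodel
  rw [← heq] at haI
  exact haI.2 haU

theorem holds_trueLits_iff {I : Set α} {b : Body α} :
    (∀ σ ∈ b.trueLits, σ.Holds (Var.Val I)) ↔ b.Sat I := by
  constructor
  · intro h
    exact ⟨fun a ha => h _ (.inl ⟨a, ha, rfl⟩), fun a ha => h _ (.inr ⟨a, ha, rfl⟩)⟩
  · rintro h _ (⟨a, ha, rfl⟩ | ⟨a, ha, rfl⟩)
    exacts [h.1 a ha, h.2 a ha]

theorem fullAssignment_solves_gamma (P : Program α) (I : Set α) (b : Body α) :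
    Solves (fullAssignment P I) (gamma b) := by
  rintro _ (rfl | ⟨σ, hσ, rfl⟩) hsub
  · have h1 := (hsub (Set.mem_insert _ _)).2
    exact h1 (holds_trueLits_iff.1 fun σ hσ => (hsub (Set.mem_insert_of_mem _ hσ)).2)
  · have h1 : b.Sat I := (hsub (Set.mem_insert _ _)).2
    have h2 := (hsub (Set.mem_insert_of_mem _ rfl)).2
    exact (SLit.holds_compl _ _).1 h2 (holds_trueLits_iff.2 h1 σ hσ)

theorem IsAnswerSet.solves_staticNogoods {P : Program α} {I : Set α} (hI : IsAnswerSet P I) :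
    Solves (fullAssignment P I) (staticNogoods P) := by
  classical
  rintro _ (⟨r, hr, hδ | rfl⟩ | ⟨r, hr, hδ⟩ | ⟨a, ha, rfl⟩)
  · exact fullAssignment_solves_gamma P I _ _ hδ
  · intro hsub
    have hbody : r.body.Sat I := (hsub (Set.mem_insert _ _)).2
    obtain ⟨a, ha, haI⟩ := hI.1 r hr hbody.2 hbody.1
    exact (hsub (Set.mem_insert_of_mem _ ⟨a, ha, rfl⟩)).2 haI
  · exact fullAssignment_solves_gamma P I _ _ hδ
  · intro hsub
    have haI : a ∈ I := (hsub (Set.mem_insert _ _)).2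
    obtain ⟨r, ⟨hr, ⟨b, hb, hba⟩, hpos⟩, hbody, hhead⟩ :=
      hI.exists_support (Set.mem_singleton a) haI
    rw [Set.mem_singleton_iff] at hba
    subst hba
    refine (hsub (Set.mem_insert_of_mem _ ⟨shiftRule r b,
      ⟨⟨r, hr, b, hb, rfl⟩, ⟨b, Finset.mem_singleton_self b, rfl⟩, hpos⟩, rfl⟩)).2 ?_
    -- As `b` is the only true head atom of `r`, the body of the shifted rule is true, too.
    refine ⟨hbody.1, fun c hc => ?_⟩
    simp only [shiftRule, Finset.mem_union, Finset.mem_erase] at hc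
    rcases hc with hc | ⟨hcb, hc⟩
    · exact hbody.2 c hc
    · exact fun hcI => hcb (hhead c hc hcI)

theorem IsAnswerSet.solves_loopNogoods {P : Program α} {I : Set α} (hI : IsAnswerSet P I)
    (U : Set α) : Solves (fullAssignment P I) (loopNogoods P U) := by
  rintro _ ⟨a, ha, s, hs, rfl⟩ hsub
  have haI : a ∈ I := (hsub (Set.mem_insert _ _)).2
  obtain ⟨r, hr, hbody, hhead⟩ := hI.exists_support ha haI
  have hsr := (hsub (Set.mem_insert_of_mem _ ⟨r, hr, rfl⟩)).2
  rcases hs r hr with h | ⟨b, hb, hbU, h⟩ <;> rw [h] at hsr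
  · exact hsr hbody
  · exact hbU (hhead b hb hsr)

/-! ### Total assignments without conflicts and unfounded sets are answer sets -/

/-- The nogoods `γ(B)` determine the literals of the rule bodies, so a total consistent assignment
solving the static nogoods is the full assignment of its true atoms. -/
theorem total_lits_eq_fullAssignment {P : Program α} {A : Set (SLit (Var α))}
    (hcons : ∀ σ ∈ A, σ.compl ∉ A) (htotal : SLit.var '' A = solverVars P)
    (hsolves : Solves A (staticNogoods P)) :
    A = fullAssignment P {a | .T (.atom a) ∈ A ∧ a ∈ atoms P} := by
  set I : Set α := {a | .T (.atom a) ∈ A ∧ a ∈ atoms P} with hI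
  have htot : ∀ σ ∈ solverLits P, σ.compl ∉ A → σ ∈ A := by
    intro σ hσ hσA
    have hvar : σ.var ∈ SLit.var '' A := by rw [htotal]; exact hσ
    obtain ⟨τ, hτ, hvar⟩ := hvar
    rcases SLit.eq_or_eq_compl hvar with rfl | rfl
    exacts [hτ, absurd hτ hσA]
  have hmem : A ⊆ solverLits P := fun σ hσ => by
    change σ.var ∈ solverVars P
    rw [← htotal]
    exact ⟨σ, hσ, rfl⟩
  have hatomT : ∀ a ∈ atoms P, (SLit.T (Var.atom a) ∈ A ↔ a ∈ I) :=
    fun a ha => ⟨fun h => ⟨h, ha⟩, fun h => h.1⟩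
  have hatomF : ∀ a ∈ atoms P, (SLit.F (Var.atom a) ∈ A ↔ a ∉ I) := fun a ha =>
    ⟨fun h h' => hcons _ h h'.1, fun h => htot (.F (.atom a)) (atom_mem_solverVars.2 ha)
      fun h' => h ⟨h', ha⟩⟩
  have hT : ∀ v, SLit.T v ∈ A → v.Val I := by
    intro v hv
    rcases hmem hv with ⟨a, ha, h⟩ | ⟨b, hb, h⟩
    · obtain rfl : v = .atom a := h
      exact (hatomT a ha).1 hv
    · obtain rfl : v = .body b := h
      obtain ⟨r, hr, rfl⟩ : ∃ r, (r ∈ P ∨ r ∈ shift P) ∧ r.body = b := by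
        rcases hb with ⟨r, hr, h⟩ | ⟨r, hr, h⟩
        exacts [⟨r, .inl hr, h⟩, ⟨r, .inr hr, h⟩]
      have key : ∀ σ ∈ r.body.trueLits, σ ∈ A := fun σ hσ =>
        htot σ (trueLits_subset_solverLits hr hσ) fun h =>
          hsolves _ (gamma_subset_staticNogoods hr (.inr ⟨σ, hσ, rfl⟩))
            (Set.insert_subset hv (Set.singleton_subset_iff.2 h))
      exact ⟨fun a ha => (hatomT a (mem_atoms_of_mem_body hr (.inl ha))).1
          (key _ (.inl ⟨a, ha, rfl⟩)),
        fun a ha => (hatomF a (mem_atoms_of_mem_body hr (.inr ha))).1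
          (key _ (.inr ⟨a, ha, rfl⟩))⟩
  have hF : ∀ v, SLit.F v ∈ A → ¬ v.Val I := by
    intro v hv
    rcases hmem hv with ⟨a, ha, h⟩ | ⟨b, hb, h⟩
    · obtain rfl : v = .atom a := h
      exact (hatomF a ha).1 hv
    · obtain rfl : v = .body b := h
      obtain ⟨r, hr, rfl⟩ : ∃ r, (r ∈ P ∨ r ∈ shift P) ∧ r.body = b := by
        rcases hb with ⟨r, hr, h⟩ | ⟨r, hr, h⟩
        exacts [⟨r, .inl hr, h⟩, ⟨r, .inr hr, h⟩]
      intro hsat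
      refine hsolves _ (gamma_subset_staticNogoods hr (.inl rfl)) (Set.insert_subset hv ?_)
      rintro _ (⟨a, ha, rfl⟩ | ⟨a, ha, rfl⟩)
      · exact (hatomT a (mem_atoms_of_mem_body hr (.inl ha))).2 (hsat.1 a ha)
      · exact (hatomF a (mem_atoms_of_mem_body hr (.inr ha))).2 (hsat.2 a ha)
  have hsub : A ⊆ fullAssignment P I := fun σ hσ => ⟨hmem hσ, by
    cases σ with
    | T v => exact hT v hσ
    | F v => exact hF v hσ⟩
  refine Set.Subset.antisymm hsub fun σ hσ => htot σ hσ.1 fun h => ?_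
  exact (compl_mem_fullAssignment hσ.1).1 (hsub h) hσ

theorem isModelOfReduct_of_solves_staticNogoods {P : Program α} {I : Set α}
    (h : Solves (fullAssignment P I) (staticNogoods P)) : IsModelOfReduct P I I := by
  intro r hr hneg hpos
  by_contra! hhead
  refine h _ (.inl ⟨r, hr, .inr rfl⟩) (Set.insert_subset
    ⟨body_mem_solverVars (.inl hr), hpos, hneg⟩ ?_)
  rintro _ ⟨a, ha, rfl⟩
  exact ⟨atom_mem_solverVars.2 ⟨r, hr, .inl ha⟩, hhead a ha⟩

theorem IsModelOfReduct.isUnfounded_diff {P : Program α} {I J : Set α} (hJI : J ⊆ I)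
    (hIP : I ⊆ atoms P) (hJ : IsModelOfReduct P I J) :
    IsUnfounded P (fullAssignment P I) (I \ J) := by
  refine ⟨Set.sdiff_subset.trans hIP, fun r hr => ?_⟩
  by_cases hbody : r.body.Sat I
  · obtain ⟨a, ha, haJ⟩ := hJ r hr.1 hbody.2 fun a ha => by
      by_contra haJ
      exact hr.2.2 a ha ⟨hbody.1 a ha, haJ⟩
    exact ⟨.T (.atom a), .inr ⟨a, ha, fun h => h.2 haJ, rfl⟩,
      atom_mem_solverVars.2 ⟨r, hr.1, .inl ha⟩, hJI haJ⟩
  · exact ⟨.F (.body r.body), .inl rfl, body_mem_solverVars (.inl hr.1), hbody⟩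

theorem isAnswerSet_of_no_unfounded {P : Program α} {I : Set α} (hIP : I ⊆ atoms P)
    (hsolves : Solves (fullAssignment P I) (staticNogoods P))
    (hU : UnfoundedSetRel P (fullAssignment P I) ∅) : IsAnswerSet P I := by
  refine ⟨isModelOfReduct_of_solves_staticNogoods hsolves, fun J hJI hJ => ?_⟩
  rcases hU with ⟨h, -⟩ | ⟨-, hno⟩
  · exact absurd h Set.not_nonempty_empty
  · refine hJI.antisymm fun a ha => ?_
    by_contra haJ
    exact hno ⟨I \ J, ⟨a, ha, haJ⟩, hJ.isUnfounded_diff hJI hIP,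
      fun b hb => ⟨atom_mem_solverVars.2 (hIP hb.1), hb.1⟩⟩

/-! ### Trails -/

theorem Trail.mem_lits_append_singleton {A : Trail α} {σ τ : SLit (Var α)} {l : ℕ} :
    σ ∈ Trail.lits (A ++ [(τ, l)]) ↔ σ ∈ A.lits ∨ σ = τ := by
  simp [Trail.lits, exists_or]

theorem State.lits_backjump_subset (S : State α) (ε : Nogood (Var α)) (k : ℕ) :
    (S.backjump ε k).trail.lits ⊆ S.trail.lits :=
  fun _ ⟨l, hl⟩ => ⟨l, List.mem_of_mem_filter hl⟩

/-! ### Consistency of the trail and preservation of the input nogoods -/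

/-- The trail contains no complementary literals. -/
def Trail.Consistent (A : Trail α) : Prop := ∀ σ ∈ A.lits, σ.compl ∉ A.lits

theorem Trail.Consistent.append_singleton {A : Trail α} (h : A.Consistent) {τ : SLit (Var α)}
    {l : ℕ} (h1 : τ ∉ A.lits) (h2 : τ.compl ∉ A.lits) :
    Trail.Consistent (A ++ [(τ, l)]) := by
  intro σ hσ hσ'
  rw [Trail.mem_lits_append_singleton] at hσ hσ'
  rcases hσ with hσ | rfl
  · rcases hσ' with hσ' | rfl
    · exact h σ hσ hσ'
    · exact h2 (by simpa using hσ)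
  · rcases hσ' with hσ' | hσ'
    · exact h2 hσ'
    · exact SLit.compl_ne _ hσ'

theorem PropStep.consistent {P : Program α} {S S' : State α} (h : PropStep P S S')
    (hS : S.trail.Consistent) : S'.trail.Consistent := by
  cases h with
  | unit δ d l hδ hd hl => exact hS.append_singleton hd.2.2.2 (by simpa using hd.2.2.1)
  | unfounded => exact hS

theorem PropStep.nabla_subset {P : Program α} {S S' : State α} (h : PropStep P S S') :
    S.nabla ⊆ S'.nabla := by
  cases h with
  | unit => exact subset_rfl
  | unfounded => exact Set.subset_insert _ _

theorem Propagation.consistent {P : Program α} {S S' : State α} (h : Propagation P S S')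
    (hS : S.trail.Consistent) : S'.trail.Consistent := by
  obtain ⟨h, -⟩ := h
  induction h with
  | refl => exact hS
  | tail _ hstep ih => exact hstep.consistent ih

theorem Propagation.nabla_subset {P : Program α} {S S' : State α} (h : Propagation P S S') :
    S.nabla ⊆ S'.nabla := by
  obtain ⟨h, -⟩ := h
  induction h with
  | refl => exact subset_rfl
  | tail _ hstep ih => exact ih.trans hstep.nabla_subset

theorem State.consistent_backjump {S : State α} (hS : S.trail.Consistent) (ε : Nogood (Var α))
    (k : ℕ) : (S.backjump ε k).trail.Consistent :=
  fun σ hσ hσ' => hS σ (S.lits_backjump_subset ε k hσ) (S.lits_backjump_subset ε k hσ')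

variable {Pred Const Ext : Type*}

theorem Branch.consistent {Q : HexProgram Pred Const Ext} {Λ : Learning Pred Const Ext}
    {S S' : State (GAtom Pred Const Ext)} (h : Branch Q Λ S (.next S'))
    (hS : S.trail.Consistent) : S'.trail.Consistent := by
  cases h with
  | conflict => exact State.consistent_backjump hS _ _
  | unfounded => exact State.consistent_backjump hS _ _
  | learn => exact hS
  | guess σ hc ht hσ h1 h2 => exact hS.append_singleton h1 h2

theorem Branch.nabla_subset {Q : HexProgram Pred Const Ext} {Λ : Learning Pred Const Ext}
    {S S' : State (GAtom Pred Const Ext)} (h : Branch Q Λ S (.next S')) : S.nabla ⊆ S'.nabla := by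
  cases h with
  | conflict => exact Set.subset_insert _ _
  | unfounded => exact Set.subset_insert _ _
  | learn => exact Set.subset_union_left
  | guess => exact subset_rfl

theorem Branch.isAnswerSet_and_solves {Q : HexProgram Pred Const Ext}
    {Λ : Learning Pred Const Ext} {S : State (GAtom Pred Const Ext)}
    {I : Set (GAtom Pred Const Ext)} (h : Branch Q Λ S (.interp I)) (hS : S.trail.Consistent) :
    IsAnswerSet (guessing Q) I ∧ Solves (fullAssignment (guessing Q) I) S.nabla := by
  cases h with
  | answer hc ht hU =>
    have hsolves : Solves S.trail.lits (S.nogoods (guessing Q)) :=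
      fun δ hδ hsub => hc ⟨δ, hδ, hsub⟩
    have heq := total_lits_eq_fullAssignment hS ht fun δ hδ => hsolves δ (.inl hδ)
    set I := {a | SLit.T (Var.atom a) ∈ S.trail.lits ∧ a ∈ atoms (guessing Q)}
    rw [heq] at hsolves hU
    exact ⟨isAnswerSet_of_no_unfounded (fun a ha => ha.2) (fun δ hδ => hsolves δ (.inl hδ)) hU,
      fun δ hδ => hsolves δ (.inr hδ)⟩

theorem Run.isAnswerSet_and_solves {Q : HexProgram Pred Const Ext} {Λ : Learning Pred Const Ext}
    {S : State (GAtom Pred Const Ext)} {o : Option (Set (GAtom Pred Const Ext))}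
    (h : Run Q Λ S o) (hS : S.trail.Consistent) {I : Set (GAtom Pred Const Ext)}
    (ho : o = some I) :
    IsAnswerSet (guessing Q) I ∧ Solves (fullAssignment (guessing Q) I) S.nabla := by
  induction h with
  | bot => cases ho
  | interp S S' I' hp hb =>
    cases ho
    obtain ⟨h1, h2⟩ := hb.isAnswerSet_and_solves (hp.consistent hS)
    exact ⟨h1, fun δ hδ => h2 δ (hp.nabla_subset hδ)⟩
  | next S S' S'' o hp hb _ ih =>
    obtain ⟨h1, h2⟩ := ih (hb.consistent (hp.consistent hS)) ho
    exact ⟨h1, fun δ hδ => h2 δ (hb.nabla_subset (hp.nabla_subset hδ))⟩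

/-! ### Soundness of the solver states for an answer set -/

/-- The nogood `δ` consists of solver literals and is solved by the interpretation `I`. -/
def SolvedNogood (P : Program α) (I : Set α) (δ : Nogood (Var α)) : Prop :=
  δ ⊆ solverLits P ∧ SolvesNogood (fullAssignment P I) δ

/-- Soundness of a solver state with respect to the interpretation `I`: the dynamic nogoods are
solved by `I`, and the literals of decision level `0` hold in `I`. -/
structure Sound (P : Program α) (I : Set α) (S : State α) : Prop where
  solved : ∀ δ ∈ S.nabla, SolvedNogood P I δ
  lits : S.trail.lits ⊆ solverLits P
  level_le : ∀ p ∈ S.trail, p.2 ≤ S.dl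
  level_zero : ∀ σ, (σ, 0) ∈ S.trail → σ ∈ fullAssignment P I

theorem IsAnswerSet.solvedNogood_static {P : Program α} {I : Set α} (hI : IsAnswerSet P I)
    {δ : Nogood (Var α)} (hδ : δ ∈ staticNogoods P) : SolvedNogood P I δ :=
  ⟨subset_solverLits_of_mem_staticNogoods hδ, hI.solves_staticNogoods δ hδ⟩

theorem IsAnswerSet.solvedNogood_loop {P : Program α} {I : Set α} (hI : IsAnswerSet P I)
    {U : Set α} (hU : U ⊆ atoms P) {δ : Nogood (Var α)} (hδ : δ ∈ loopNogoods P U) :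
    SolvedNogood P I δ :=
  ⟨subset_solverLits_of_mem_loopNogoods hU hδ, hI.solves_loopNogoods U δ hδ⟩

theorem Sound.solvedNogood {P : Program α} {I : Set α} {S : State α} (hS : Sound P I S)
    (hI : IsAnswerSet P I) {δ : Nogood (Var α)} (hδ : δ ∈ S.nogoods P) : SolvedNogood P I δ :=
  hδ.elim hI.solvedNogood_static (hS.solved δ)

theorem Sound.subset_fullAssignment {P : Program α} {I : Set α} {S : State α} (hS : Sound P I S)
    {δ : Set (SLit (Var α))} (hA : δ ⊆ S.trail.lits) (h0 : ∀ l ∈ S.trail.levels δ, l = 0) :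
    δ ⊆ fullAssignment P I := by
  intro σ hσ
  obtain ⟨l, hl⟩ := hA hσ
  obtain rfl := h0 l ⟨σ, hσ, hl⟩
  exact hS.level_zero σ hl

/-- A nogood that is solved by `I` cannot be violated at decision level `0`. -/
theorem Sound.not_subset_of_levels_zero {P : Program α} {I : Set α} {S : State α}
    (hS : Sound P I S) {δ : Nogood (Var α)} (hδ : SolvedNogood P I δ)
    (h0 : ∀ l ∈ S.trail.levels δ, l = 0) : ¬ δ ⊆ S.trail.lits :=
  fun hA => hδ.2 (hS.subset_fullAssignment hA h0)

/-- Resolution is sound because `I` assigns the resolved literal, one way or the other. -/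
theorem SolvedNogood.resolve {P : Program α} {I : Set α} {δ ρ : Nogood (Var α)}
    {σ : SLit (Var α)} (hσ : σ ∈ δ) (hδ : SolvedNogood P I δ) (hρ : SolvedNogood P I ρ) :
    SolvedNogood P I ((δ \ {σ}) ∪ (ρ \ {σ.compl})) := by
  refine ⟨Set.union_subset (Set.sdiff_subset.trans hδ.1) (Set.sdiff_subset.trans hρ.1),
    fun hsub => ?_⟩
  rw [Set.union_subset_iff, Set.sdiff_singleton_subset_iff, Set.sdiff_singleton_subset_iff] at hsub
  by_cases h : σ ∈ fullAssignment P I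
  · exact hδ.2 (hsub.1.trans (Set.insert_subset h subset_rfl))
  · exact hρ.2 (hsub.2.trans (Set.insert_subset
      ((compl_mem_fullAssignment (hδ.1 hσ)).2 h) subset_rfl))

theorem AnalysisRel.solvedNogood {P : Program α} {I : Set α} {N : Set (Nogood (Var α))}
    {A : Trail α} {δ ε : Nogood (Var α)} {k : ℕ} (h : AnalysisRel N A δ ε k)
    (hN : ∀ ρ ∈ N, SolvedNogood P I ρ) (hδ : SolvedNogood P I δ) : SolvedNogood P I ε := by
  induction h with
  | learned => exact hδ
  | resolve δ σ ρ ε k _ hσ hρ _ _ ih => exact ih (hδ.resolve hσ.1 (hN ρ hρ))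

theorem Sound.backjump {P : Program α} {I : Set α} {S : State α} (hS : Sound P I S)
    {ε : Nogood (Var α)} (hε : SolvedNogood P I ε) (k : ℕ) : Sound P I (S.backjump ε k) where
  solved := by
    rintro δ (rfl | hδ)
    exacts [hε, hS.solved δ hδ]
  lits := (S.lits_backjump_subset ε k).trans hS.lits
  level_le _ hp := of_decide_eq_true (List.mem_filter.1 hp).2
  level_zero σ hσ := hS.level_zero σ (List.mem_of_mem_filter hσ)

theorem PropStep.sound {P : Program α} {I : Set α} (hI : IsAnswerSet P I) {S S' : State α}
    (h : PropStep P S S') (hS : Sound P I S) : Sound P I S' := by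
  cases h with
  | unit δ d l hδ hd hl =>
    obtain ⟨hdδ, hsub, -, -⟩ := hd
    have hδ' := hS.solvedNogood hI hδ
    have hdlit := hδ'.1 hdδ
    refine ⟨hS.solved, fun σ hσ => ?_, fun p hp => ?_, fun σ hσ => ?_⟩
    · rcases Trail.mem_lits_append_singleton.1 hσ with hσ | rfl
      exacts [hS.lits hσ, compl_mem_solverLits.2 hdlit]
    · rcases List.mem_append.1 hp with hp | hp
      · exact hS.level_le p hp
      · obtain rfl := List.mem_singleton.1 hp
        rcases hl.1 with h | ⟨τ, -, h⟩
        · exact h.le.trans (Nat.zero_le _)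
        · exact hS.level_le (τ, l) h
    · rcases List.mem_append.1 hσ with hσ | hσ
      · exact hS.level_zero σ hσ
      · obtain ⟨rfl, rfl⟩ := Prod.mk.inj (List.mem_singleton.1 hσ)
        -- All other literals of `δ` have level `0`, so they hold in `I`, and `d` does not.
        rw [compl_mem_fullAssignment hdlit]
        intro hdI
        have hrest := hS.subset_fullAssignment hsub fun m hm =>
          Nat.le_zero.1 (hl.2 (Set.mem_insert_of_mem _ hm))
        rw [Set.sdiff_singleton_subset_iff, Set.insert_eq_of_mem hdI] at hrest
        exact hδ'.2 hrest
  | unfounded U a δ hU ha haF hδ hA =>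
    refine ⟨?_, hS.lits, hS.level_le, hS.level_zero⟩
    rintro ε (rfl | hε)
    · exact hI.solvedNogood_loop hU.1 ⟨a, ha, hδ⟩
    · exact hS.solved ε hε

theorem Propagation.sound {P : Program α} {I : Set α} (hI : IsAnswerSet P I) {S S' : State α}
    (h : Propagation P S S') (hS : Sound P I S) : Sound P I S' := by
  obtain ⟨h, -⟩ := h
  induction h with
  | refl => exact hS
  | tail _ hstep ih => exact hstep.sound hI ih

theorem UnfoundedSetRel.subset_atoms {P : Program α} {A : Set (SLit (Var α))} {U : Set α}
    (h : UnfoundedSetRel P A U) : U ⊆ atoms P := by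
  rcases h with ⟨-, h, -⟩ | ⟨rfl, -⟩
  exacts [h.1, Set.empty_subset _]

theorem Branch.sound {f : Oracle Pred Const Ext} {Q : HexProgram Pred Const Ext}
    {Λ : Learning Pred Const Ext} (hΛ : IsLearningFunction Q Λ)
    (hcorrect : IsCorrectLearning f Q Λ) {I : Set (GAtom Pred Const Ext)}
    (hI : IsCompatibleSet f Q I) {S S' : State (GAtom Pred Const Ext)}
    (h : Branch Q Λ S (.next S')) (hS : Sound (guessing Q) I S) : Sound (guessing Q) I S' := by
  cases h with
  | conflict δ ε k hδ hA h0 han =>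
    exact hS.backjump (han.solvedNogood (fun ρ hρ => hS.solvedNogood hI.1 hρ)
      (hS.solvedNogood hI.1 hδ)) k
  | unfounded U δ ε k hc ht hU hne hδ hA h0 han =>
    exact hS.backjump (han.solvedNogood (fun ρ hρ => hS.solvedNogood hI.1 hρ)
      (hI.1.solvedNogood_loop hU.subset_atoms hδ)) k
  | learn g hc ht hg =>
    refine ⟨?_, hS.lits, hS.level_le, hS.level_zero⟩
    rintro δ (hδ | hδ)
    · exact hS.solved δ hδ
    · exact ⟨hΛ g hg _ hS.lits δ hδ, hcorrect g hg _ hS.lits δ hδ I hI⟩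
  | guess σ hc ht hσ h1 h2 =>
    refine ⟨hS.solved, fun τ hτ => ?_, fun p hp => ?_, fun τ hτ => ?_⟩
    · rcases Trail.mem_lits_append_singleton.1 hτ with hτ | rfl
      exacts [hS.lits hτ, hσ]
    · rcases List.mem_append.1 hp with hp | hp
      · exact (hS.level_le p hp).trans (Nat.le_succ _)
      · obtain rfl := List.mem_singleton.1 hp
        exact le_rfl
    · rcases List.mem_append.1 hτ with hτ | hτ
      · exact hS.level_zero τ hτ
      · simp at hτ

theorem Branch.not_sound_of_bot {Q : HexProgram Pred Const Ext} {Λ : Learning Pred Const Ext}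
    {I : Set (GAtom Pred Const Ext)} (hI : IsAnswerSet (guessing Q) I)
    {S : State (GAtom Pred Const Ext)} (h : Branch Q Λ S .bot) : ¬ Sound (guessing Q) I S := by
  intro hS
  cases h with
  | conflictBot hc h0 =>
    obtain ⟨δ, hδ, hA⟩ := hc
    refine hS.not_subset_of_levels_zero (hS.solvedNogood hI hδ) ?_ hA
    rintro l ⟨σ, -, hl⟩
    exact Nat.le_zero.1 (h0 ▸ hS.level_le _ hl)
  | unfoundedBot U δ hc ht hU hne hδ hA h0 =>
    exact hS.not_subset_of_levels_zero (hI.solvedNogood_loop hU.subset_atoms hδ) h0 hA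

theorem Run.not_sound_of_none {f : Oracle Pred Const Ext} {Q : HexProgram Pred Const Ext}
    {Λ : Learning Pred Const Ext} (hΛ : IsLearningFunction Q Λ)
    (hcorrect : IsCorrectLearning f Q Λ) {I : Set (GAtom Pred Const Ext)}
    (hI : IsCompatibleSet f Q I) {S : State (GAtom Pred Const Ext)}
    {o : Option (Set (GAtom Pred Const Ext))} (h : Run Q Λ S o) (ho : o = none) :
    ¬ Sound (guessing Q) I S := by
  induction h with
  | bot S S' hp hb => exact fun hS => hb.not_sound_of_bot hI.1 (hp.sound hI.1 hS)
  | interp => cases ho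
  | next S S' S'' o hp hb _ ih =>
    exact fun hS => ih ho (hb.sound hΛ hcorrect hI (hp.sound hI.1 hS))

end HexCDNL

/-! ### Correctness of returned interpretations and of `⊥` -/

theorem mainTheorem1 {Pred Const Ext : Type*}
    (f : HexCDNL.Oracle Pred Const Ext) (Q : HexCDNL.HexProgram Pred Const Ext) (hQ : Q.Finite)
    (Λ : HexCDNL.Learning Pred Const Ext) (hΛ : HexCDNL.IsLearningFunction Q Λ)
    (hcorrect : HexCDNL.IsCorrectLearning f Q Λ)
    (nabla : Set (HexCDNL.Nogood (HexCDNL.Var (HexCDNL.GAtom Pred Const Ext))))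
    (hnabla : ∀ δ ∈ nabla, δ ⊆ HexCDNL.solverLits (HexCDNL.guessing Q)) :
    (∀ I : Set (HexCDNL.GAtom Pred Const Ext), HexCDNL.Returns Q Λ nabla (some I) →
      HexCDNL.IsAnswerSet (HexCDNL.guessing Q) I ∧
        HexCDNL.Solves (HexCDNL.fullAssignment (HexCDNL.guessing Q) I) nabla) ∧
    (HexCDNL.Returns Q Λ nabla none →
      ¬ ∃ I : Set (HexCDNL.GAtom Pred Const Ext), HexCDNL.IsCompatibleSet f Q I ∧
        HexCDNL.Solves (HexCDNL.fullAssignment (HexCDNL.guessing Q) I) nabla) := by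
  refine ⟨fun I h => HexCDNL.Run.isAnswerSet_and_solves h ?_ rfl, ?_⟩
  · rintro σ ⟨l, hl⟩
    simp at hl
  · rintro h ⟨I, hI, hsolves⟩
    refine HexCDNL.Run.not_sound_of_none hΛ hcorrect hI h rfl
      ⟨fun δ hδ => ⟨hnabla δ hδ, hsolves δ hδ⟩, ?_, by simp, by simp⟩
    rintro σ ⟨l, hl⟩
    simp at hl
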